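/- Let $R$ be a local noetherian domain of Krull dimension $1$ with maximal ideal $\mathfrak m$, and assume that its $\mathfrak m$-adic completion $\widehat R$ is reduced. Let $K(\widehat R)$ denote the total quotient ring of $\widehat R$, that is, the localization of $\widehat R$ at the set of all its non-zero-divisors. For a module $M$ over a commutative ring $A$, let $\mathrm{Add}(M)$ be the class of $A$-modules that are isomorphic to a direct summand of a direct sum of arbitrarily many copies of $M$. An $\widehat R$-module $N$ is said to be \emph{extended} from an $R$-module $X$ if $N\cong X\otimes_R\widehat R$ as $\widehat R$-modules. Let $M$ be a finitely generated torsion-free $R$-module, and put $\widehat M=M\otimes_R\widehat R$. Then for every countably generated $\widehat R$-module $N\in\mathrm{Add}(\widehat M)$ the following statements are equivalent: (i) $N$ is extended from some $R$-module; (ii) there exists a countable (possibly finite or empty) set $\Lambda$ such that $N\otimes_{\widehat R}K(\widehat R)\cong K(\widehat R)^{(\Lambda)}$ as $K(\widehat R)$-modules, where $K(\widehat R)^{(\Lambda)}$ is the direct sum of copies of $K(\widehat R)$ indexed by $\Lambda$; (iii) $N$ is extended from some countably generated $R$-module belonging to $\mathrm{Add}(M)$. -/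

import Mathlib

open scoped TensorProduct

universe u v w x

/-- The completion of a local ring `R` at its maximal ideal. -/
abbrev LocalCompletion (R : Type u) [CommRing R] [IsLocalRing R] : Type u :=
  AdicCompletion (IsLocalRing.maximalIdeal R) R

/-- An `A`-module generated by a countable (possibly finite or empty) set. -/
def IsCountablyGenerated (A : Type u) [CommRing A] (N : Type w) [AddCommGroup N] [Module A N] :
    Prop :=
  ∃ s : Set N, s.Countable ∧ Submodule.span A s = ⊤

/-- `N` belongs to `Add(M)`: it is isomorphic to a direct summand of a direct sum of copies of `M`,
over an index set of arbitrary cardinality. It is no restriction that the index type lives in the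
universe of `N`: the union of the (finite) supports of the elements of a copy of `N` inside a direct
sum of copies of `M` has at most `max |N| ℵ₀` elements, and the other summands can be discarded. -/
def MemAdd (A : Type u) [CommRing A] (M : Type v) [AddCommGroup M] [Module A M]
    (N : Type w) [AddCommGroup N] [Module A N] : Prop :=
  ∃ (ι : Type w) (P : Submodule A (ι →₀ M)), IsComplemented P ∧ Nonempty (N ≃ₗ[A] P)

/-- The module `N` over the completion of `R` is extended from the `R`-module `X`: it is isomorphic,
over the completion, to the base change of `X`. -/
def IsExtendedFrom (R : Type u) [CommRing R] [IsLocalRing R]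
    (N : Type w) [AddCommGroup N] [Module (LocalCompletion R) N]
    (X : Type v) [AddCommGroup X] [Module R X] : Prop :=
  Nonempty (N ≃ₗ[LocalCompletion R] (LocalCompletion R ⊗[R] X))

/-! Write `A` for the completion and `K` for its total quotient ring. (i) ⇒ (ii): since `R` is a
domain and `A` is flat over it, base change of `X` to `K` passes through a vector space over the
fraction field of `R`, hence is free; the basis is countable because `N` is countably generated.
(ii) ⇒ (iii): fix a nonzero `a` in the maximal ideal. In dimension one every non-zero-divisor of `A`
divides a power of `a`, so clearing denominators in a `K`-basis gives a free submodule of `N` with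
`a`-power torsion cokernel. As `A = R + a ^ m A`, the elements of `N` that some power of `a` carries
into the `R`-span of that basis form an `R`-module `X` with `A ⊗ X ≅ N`
(`exists_linearEquiv_baseChange_of_linearIndependent`). Countable generation and membership in
`Add(M)` then descend along the faithfully flat map `R → A` (`MemAdd.of_baseChange`): on finitely
generated submodules of `X` the identity factors through finite sums of copies of `M`, and these
factorizations are glued along a countable chain exhausting `X`. -/

/-! ### Retracts of direct sums of copies of `M` -/

/-- A module in `Add(M)` is locally (on finite sets) a retract of a finite sum of copies of `M`. -/
theorem MemAdd.exists_sum_eq {A : Type u} [CommRing A] {M : Type v} [AddCommGroup M] [Module A M]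
    {N : Type w} [AddCommGroup N] [Module A N] (h : MemAdd A M N) (F : Finset N) :
    ∃ (ι : Type w) (t : Finset ι) (G : ι → N →ₗ[A] M) (H : ι → M →ₗ[A] N),
      ∀ z ∈ F, ∑ j ∈ t, H j (G j z) = z := by
  classical
  obtain ⟨ι, P, ⟨Q, hPQ⟩, ⟨e⟩⟩ := h
  let p := P.projectionOnto Q hPQ
  refine ⟨ι, F.biUnion fun z => (e z : ι →₀ M).support,
    fun j => Finsupp.lapply j ∘ₗ P.subtype ∘ₗ e.toLinearMap,
    fun j => e.symm.toLinearMap ∘ₗ p ∘ₗ Finsupp.lsingle j, fun z hz => ?_⟩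
  have h1 : ((e z : ι →₀ M).sum Finsupp.single) = e z := Finsupp.sum_single _
  have h2 : e.symm (p (e z : ι →₀ M)) = z := by
    simp [p]
  conv_rhs => rw [← h2, ← h1]
  rw [Finsupp.sum_of_support_subset (s := F.biUnion fun z => (e z : ι →₀ M).support)]
  · simp
  · exact fun j hj => Finset.mem_biUnion.2 ⟨z, hz, hj⟩
  · simp

/-- A module is in `Add(M)` as soon as it is a retract of a direct sum of copies of `M`. -/
theorem memAdd_of_leftInverse {A : Type u} [CommRing A] {M : Type v} [AddCommGroup M] [Module A M]
    {N : Type w} [AddCommGroup N] [Module A N] {ι : Type w} (i : N →ₗ[A] (ι →₀ M))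
    (p : (ι →₀ M) →ₗ[A] N) (h : ∀ x, p (i x) = x) : MemAdd A M N := by
  have hi : Function.Injective i := Function.LeftInverse.injective h
  refine ⟨ι, LinearMap.range i, ?_, ⟨LinearEquiv.ofInjective i hi⟩⟩
  refine ⟨LinearMap.ker (i.rangeRestrict ∘ₗ p), LinearMap.isCompl_of_proj ?_⟩
  rintro ⟨_, x, rfl⟩
  ext1
  simp [h]

/-! ### Faithfully flat descent on finitely generated submodules -/

theorem LinearMap.mem_span_range_baseChange {R : Type*} [CommRing R] {A : Type*} [CommRing A]
    [Algebra R A] [Module.Flat R A] {P Q : Type*} [AddCommGroup P] [Module R P] [AddCommGroup Q]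
    [Module R Q] [Module.FinitePresentation R P] (φ : A ⊗[R] P →ₗ[A] A ⊗[R] Q) :
    φ ∈ Submodule.span A (Set.range fun f : P →ₗ[R] Q => f.baseChange A) := by
  refine (Module.FinitePresentation.isBaseChange_map R P Q A).inductionOn φ _ ?_ ?_ ?_ ?_
  · exact zero_mem _
  · exact fun f => Submodule.subset_span ⟨f, rfl⟩
  · exact fun a f hf => Submodule.smul_mem _ a hf
  · exact fun f g hf hg => add_mem hf hg

theorem Submodule.mem_of_one_tmul_mem_baseChange {R : Type*} [CommRing R] (A : Type*) [CommRing A]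
    [Algebra R A] [Module.FaithfullyFlat R A] {L : Type*} [AddCommGroup L] [Module R L]
    (I : Submodule R L) {x : L} (hx : (1 : A) ⊗ₜ[R] x ∈ I.baseChange A) : x ∈ I := by
  rw [← Submodule.Quotient.mk_eq_zero, ← Module.FaithfullyFlat.one_tmul_eq_zero_iff R (L ⧸ I) (A := A)]
  have h : I.baseChange A ≤ LinearMap.ker (I.mkQ.baseChange A) := by
    rw [Submodule.baseChange_eq_span, Submodule.span_le]
    rintro _ ⟨y, hy, rfl⟩
    simpa using hy
  simpa using h hx

/-- Factoring the inclusion of `Y` through copies of `M` is a membership problem for a submodule of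
a finite power of `X`, and faithful flatness descends its solution from `A`. The maps out of `A ⊗ X`
are restricted to `A ⊗ Z`, since only for finitely presented `Z` are they combinations of base
changes. It is essential that `S` does not depend on `Z`: later `Z` is chosen to contain the images
of `S`. -/
theorem MemAdd.exists_finset_sum_eq_of_baseChange {R : Type*} [CommRing R] [IsNoetherianRing R]
    (A : Type*) [CommRing A] [Algebra R A] [Module.FaithfullyFlat R A]
    {M : Type*} [AddCommGroup M] [Module R M] [Module.Finite R M]
    {X : Type*} [AddCommGroup X] [Module R X] {N : Type*} [AddCommGroup N] [Module A N]
    (hN : MemAdd A (A ⊗[R] M) N) (ψ : N ≃ₗ[A] A ⊗[R] X)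
    {Y : Submodule R X} (hY : Y.FG) :
    ∃ S : Finset (M →ₗ[R] X), ∀ Z : Submodule R X, Z.FG → Y ≤ Z →
      ∃ g : S → Z →ₗ[R] M, ∀ y (hy : y ∈ Z), y ∈ Y → ∑ h : S, h.1 (g h ⟨y, hy⟩) = y := by
  classical
  obtain ⟨F, rfl⟩ := hY
  obtain ⟨ι, t, G, H, hGH⟩ : ∃ (ι : Type _) (t : Finset ι) (G : ι → A ⊗[R] X →ₗ[A] A ⊗[R] M)
      (H : ι → A ⊗[R] M →ₗ[A] A ⊗[R] X),
        ∀ y ∈ F, ∑ j ∈ t, H j (G j (1 ⊗ₜ[R] y)) = (1 : A) ⊗ₜ[R] y := by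
    obtain ⟨ι, t, G, H, hGH⟩ := hN.exists_sum_eq (F.image fun y => ψ.symm (1 ⊗ₜ[R] y))
    refine ⟨ι, t, fun j => G j ∘ₗ ψ.symm.toLinearMap, fun j => ψ.toLinearMap ∘ₗ H j,
      fun y hy => ?_⟩
    have h := congrArg ψ (hGH _ (Finset.mem_image_of_mem _ hy))
    rw [map_sum, ψ.apply_symm_apply] at h
    exact h
  have : Module.FinitePresentation R M := Module.finitePresentation_of_finite R M
  obtain ⟨S, hS⟩ : ∃ S : Finset (M →ₗ[R] X), ∀ j ∈ t,
      H j ∈ Submodule.span A (Set.range fun h : S => h.1.baseChange A) := by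
    choose c hc using fun j => Finsupp.mem_span_range_iff_exists_finsupp.1
      (LinearMap.mem_span_range_baseChange (H j))
    refine ⟨t.biUnion fun j => (c j).support, fun j hj => ?_⟩
    rw [← hc j]
    exact sum_mem fun h hh => Submodule.smul_mem _ _
      (Submodule.subset_span ⟨⟨h, Finset.mem_biUnion.2 ⟨j, hj, hh⟩⟩, rfl⟩)
  refine ⟨S, fun Z hZ hFZ => ?_⟩
  have : Module.Finite R Z := Module.Finite.iff_fg.2 hZ
  have : Module.FinitePresentation R Z := Module.finitePresentation_of_finite R Z
  let yy : F → Z := fun y => ⟨y, hFZ (Submodule.subset_span y.2)⟩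
  -- The range of `Θ` consists of the values on the generators `F` of all sums `∑ h ∘ g h`; the goal
  -- is that the tuple of generators itself lies in it.
  let Θ : (S → Z →ₗ[R] M) →ₗ[R] (F → X) :=
    LinearMap.pi fun y => ∑ h : S, h.1 ∘ₗ LinearMap.applyₗ (yy y) ∘ₗ LinearMap.proj h
  have hΘ : ∀ g y, Θ g y = ∑ h : S, h.1 (g h (yy y)) := by
    intro g y; simp [Θ]
  let E := TensorProduct.piRight R A A (fun _ : F => X)
  have key : ∀ (h' : A ⊗[R] M →ₗ[A] A ⊗[R] X) (g' : A ⊗[R] Z →ₗ[A] A ⊗[R] M),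
      h' ∈ Submodule.span A (Set.range fun h : S => h.1.baseChange A) →
      E.symm (fun y => h' (g' (1 ⊗ₜ yy y))) ∈ (LinearMap.range Θ).baseChange A := by
    intro h' g' hh'
    let Ψ : (A ⊗[R] M →ₗ[A] A ⊗[R] X) →ₗ[A] (A ⊗[R] Z →ₗ[A] A ⊗[R] M) →ₗ[A] A ⊗[R] (F → X) :=
      LinearMap.mk₂ A (fun h' g' => E.symm (fun y => h' (g' (1 ⊗ₜ yy y))))
        (fun _ _ _ => by rw [← map_add]; rfl) (fun _ _ _ => by rw [← map_smul]; rfl)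
        (fun _ _ _ => by rw [← map_add]; congr 1; ext; simp)
        (fun _ _ _ => by rw [← map_smul]; congr 1; ext; simp)
    change Ψ h' g' ∈ _
    have hg' := LinearMap.mem_span_range_baseChange g'
    induction hh', hg' using Submodule.span_induction₂ with
    | mem_mem h' g' hh hg =>
      obtain ⟨h, rfl⟩ := hh
      obtain ⟨g, rfl⟩ := hg
      have : Ψ (h.1.baseChange A) (g.baseChange A) = 1 ⊗ₜ Θ (Pi.single h g) := by
        change E.symm _ = _
        rw [LinearEquiv.symm_apply_eq]
        ext y
        simp [E, hΘ, Pi.single_apply, ite_apply, apply_ite]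
      rw [this]
      exact Submodule.tmul_mem_baseChange_of_mem _ ⟨_, rfl⟩
    | zero_left => simp
    | zero_right => simp
    | add_left _ _ _ _ _ _ h1 h2 => rw [map_add]; exact add_mem h1 h2
    | add_right _ _ _ _ _ _ h1 h2 => rw [map_add]; exact add_mem h1 h2
    | smul_left r _ _ _ _ h => rw [map_smul]; exact Submodule.smul_mem _ r h
    | smul_right r _ _ _ _ h => rw [map_smul]; exact Submodule.smul_mem _ r h
  have hmem : (fun y : F => (y : X)) ∈ LinearMap.range Θ := by
    refine Submodule.mem_of_one_tmul_mem_baseChange A _ ?_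
    have : (1 : A) ⊗ₜ[R] (fun y : F => (y : X)) =
        ∑ j ∈ t, E.symm fun y => H j ((G j ∘ₗ Z.subtype.baseChange A) (1 ⊗ₜ yy y)) := by
      rw [← map_sum, LinearEquiv.eq_symm_apply]
      ext y
      simpa [E, yy] using (hGH y y.2).symm
    rw [this]
    exact sum_mem fun j hj => key _ _ (hS j hj)
  obtain ⟨g, hg⟩ := hmem
  refine ⟨g, fun y hy hyF => ?_⟩
  let φ : Z →ₗ[R] X := ∑ h : S, h.1 ∘ₗ g h
  have hφ : Submodule.span R (F : Set X) ≤
      (LinearMap.eqLocus φ Z.subtype).map Z.subtype := by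
    rw [Submodule.span_le]
    intro y hy
    refine ⟨yy ⟨y, hy⟩, ?_, rfl⟩
    have := congrFun hg ⟨y, hy⟩
    rw [hΘ] at this
    simpa [φ] using this
  obtain ⟨z, hz, hzy⟩ := hφ hyF
  obtain rfl : z = ⟨y, hy⟩ := Subtype.ext hzy
  simpa [φ] using hz

/-! ### Gluing along an exhausting chain -/

section

variable {R : Type*} [Ring R] {X : Type*} [AddCommGroup X] [Module R X]
  {P : Type*} [AddCommGroup P] [Module R P]

/-- Compatible linear maps on the members of an exhausting chain of submodules glue. -/
theorem exists_linearMap_of_monotone (Z : ℕ → Submodule R X) (hZ : Monotone Z)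
    (hex : ∀ x, ∃ n, x ∈ Z n) (θ : ∀ n, Z n →ₗ[R] P)
    (hθ : ∀ n x (hx : x ∈ Z n), θ (n + 1) ⟨x, hZ n.le_succ hx⟩ = θ n ⟨x, hx⟩) :
    ∃ ψ : X →ₗ[R] P, ∀ n x (hx : x ∈ Z n), ψ x = θ n ⟨x, hx⟩ := by
  have hle : ∀ n m (h : n ≤ m) x (hx : x ∈ Z n), θ m ⟨x, hZ h hx⟩ = θ n ⟨x, hx⟩ := by
    intro n m h
    induction m, h using Nat.le_induction with
    | base => intro x hx; rfl
    | succ m h ih => intro x hx; rw [hθ m x (hZ h hx), ih]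
  choose n hn using hex
  have key : ∀ m x (hx : x ∈ Z m), θ (n x) ⟨x, hn x⟩ = θ m ⟨x, hx⟩ := fun m x hx => by
    rw [← hle _ _ (le_max_left (n x) m), ← hle _ _ (le_max_right (n x) m)]
  refine ⟨{ toFun := fun x => θ (n x) ⟨x, hn x⟩, map_add' := fun x y => ?_,
            map_smul' := fun r x => ?_ }, fun m x hx => key m x hx⟩
  · have hx := hZ (le_max_left (n x) (n y)) (hn x)
    have hy := hZ (le_max_right (n x) (n y)) (hn y)
    rw [key _ _ hx, key _ _ hy, key _ _ (add_mem hx hy), ← map_add]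
    rfl
  · rw [key _ _ ((Z (n x)).smul_mem r (hn x)), RingHom.id_apply, ← map_smul]
    rfl

/-- A Mittag-Leffler argument: composing `φ` with more and more of the `e n` defines maps on all `Z
(n + 1)`, and consecutive ones agree on `Z n`. One index is lost, so `φ` is only kept on `Z 0`. -/
theorem exists_linearMap_extending (Z : ℕ → Submodule R X) (hZ : Monotone Z)
    (hex : ∀ x, ∃ n, x ∈ Z n) (e : ∀ n, Z (n + 2) →ₗ[R] Z (n + 1))
    (he : ∀ n x (hx : x ∈ Z n), e n ⟨x, hZ (Nat.le_add_right n 2) hx⟩ = ⟨x, hZ n.le_succ hx⟩)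
    (φ : Z 1 →ₗ[R] P) :
    ∃ ψ : X →ₗ[R] P, ∀ x (hx : x ∈ Z 0), ψ x = φ ⟨x, hZ zero_le_one hx⟩ := by
  let θ : ∀ n, Z (n + 1) →ₗ[R] P := fun n =>
    Nat.rec (motive := fun n => Z (n + 1) →ₗ[R] P) φ (fun n f => f ∘ₗ e n) n
  obtain ⟨ψ, hψ⟩ := exists_linearMap_of_monotone Z hZ hex
    (fun n => θ n ∘ₗ Submodule.inclusion (hZ n.le_succ))
    (fun n x hx => by
      change θ n (e n _) = θ n _
      exact congrArg _ (he n x hx))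
  exact ⟨ψ, fun x hx => hψ 0 x hx⟩

/-- Idempotent-like approximations of the identity that factor through sums of copies of `M`
split `X` off a direct sum of copies of `M`. -/
theorem exists_leftInverse_of_approx {M : Type*} [AddCommGroup M] [Module R M]
    (Y : ℕ → Submodule R X) (hY : Monotone Y) (hex : ∀ x, ∃ n, x ∈ Y n)
    {κ : ℕ → Type*} [∀ n, Fintype (κ n)] (h : ∀ n, κ n → M →ₗ[R] X) (G : ∀ n, κ n → X →ₗ[R] M)
    (hid : ∀ n, ∀ x ∈ Y n, ∑ k, h n k (G n k x) = x)
    (hrange : ∀ n x, ∑ k, h n k (G n k x) ∈ Y (n + 1)) :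
    ∃ (i : X →ₗ[R] ((Σ n, κ n) →₀ M)) (p : ((Σ n, κ n) →₀ M) →ₗ[R] X), ∀ x, p (i x) = x := by
  classical
  let f : ℕ → X →ₗ[R] X := fun n => ∑ k, h n k ∘ₗ G n k
  have hf : ∀ n x, f n x = ∑ k, h n k (G n k x) := fun n x => by simp [f]
  -- Since `f (n + 1) ∘ f n = f n`, the sum of `f n ∘ c n` telescopes: `f 0 + (f 1 - f 0) + ⋯`,
  -- which on `Y N` stops at `f N = id`.
  let c : ℕ → X →ₗ[R] X := fun n => Nat.casesOn n LinearMap.id fun n => LinearMap.id - f n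
  have hc : ∀ N, ∀ x ∈ Y N, ∀ n, N < n → c n x = 0 := by
    intro N x hx n hn
    obtain ⟨n, rfl⟩ : ∃ m, n = m + 1 := ⟨n - 1, by omega⟩
    change x - f n x = 0
    rw [hf, hid n x (hY (by omega) hx), sub_self]
  have hfin : ∀ x, (Function.support fun s : Σ n, κ n => G s.1 s.2 (c s.1 x)).Finite := by
    intro x
    obtain ⟨N, hN⟩ := hex x
    refine ((Finset.range (N + 1)).sigma fun _ => Finset.univ).finite_toSet.subset ?_
    rintro ⟨n, k⟩ hs
    by_contra hn
    simp only [Finset.coe_sigma, Set.mem_sigma_iff, Finset.mem_coe, Finset.mem_range,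
      Finset.mem_univ, and_true, not_lt] at hn
    exact hs (by simp [hc N x hN n hn])
  let i : X →ₗ[R] ((Σ n, κ n) →₀ M) :=
    { toFun := fun x => Finsupp.ofSupportFinite _ (hfin x)
      map_add' := fun x y => by ext; simp [Finsupp.ofSupportFinite_coe]
      map_smul' := fun r x => by ext; simp [Finsupp.ofSupportFinite_coe] }
  have hi : ∀ x s, i x s = G s.1 s.2 (c s.1 x) := fun x s => rfl
  refine ⟨i, Finsupp.lsum ℕ fun s => h s.1 s.2, fun x => ?_⟩
  obtain ⟨N, hN⟩ := hex x
  rw [Finsupp.lsum_apply, Finsupp.sum_of_support_subset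
    (s := (Finset.range (N + 1)).sigma fun _ => Finset.univ)]
  · rw [Finset.sum_sigma]
    simp only [hi, ← hf]
    have : ∀ n, ∑ m ∈ Finset.range (n + 1), f m (c m x) = f n x := by
      intro n
      induction n with
      | zero => simp [c]
      | succ n ih =>
        rw [Finset.sum_range_succ, ih]
        change f n x + f (n + 1) (x - f n x) = _
        have : f (n + 1) (f n x) = f n x := by
          rw [hf (n + 1), hid _ _ (by rw [hf]; exact hrange n x)]
        rw [map_sub, this, add_sub_cancel]
    rw [this, hf, hid N x hN]
  · rintro ⟨n, k⟩ hs
    rw [Finsupp.mem_support_iff, hi] at hs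
    simp only [Finset.mem_sigma, Finset.mem_range, Finset.mem_univ, and_true]
    by_contra hn
    exact hs (by simp [hc N x hN n (by omega)])
  · simp

end

/-! ### Descent of `Add(M)` and of countable generation -/

theorem IsCountablyGenerated.exists_seq {A : Type u} [CommRing A] {N : Type w} [AddCommGroup N]
    [Module A N] (h : IsCountablyGenerated A N) :
    ∃ s : ℕ → N, Submodule.span A (Set.range s) = ⊤ := by
  obtain ⟨s, hs, hs'⟩ := h
  obtain ⟨f, hf⟩ := (hs.insert 0).exists_eq_range (Set.insert_nonempty 0 s)
  exact ⟨f, by rw [← hf, Submodule.span_insert_zero, hs']⟩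

/-- Descent of `Add(M)` along faithfully flat ring extensions. -/
theorem MemAdd.of_baseChange {R : Type u} [CommRing R] [IsNoetherianRing R]
    (A : Type*) [CommRing A] [Algebra R A] [Module.FaithfullyFlat R A]
    {M : Type v} [AddCommGroup M] [Module R M] [Module.Finite R M]
    {X : Type w} [AddCommGroup X] [Module R X] (hXc : IsCountablyGenerated R X)
    {N : Type*} [AddCommGroup N] [Module A N] (hN : MemAdd A (A ⊗[R] M) N)
    (ψ : N ≃ₗ[A] A ⊗[R] X) : MemAdd R M X := by
  classical
  obtain ⟨s, hs⟩ := hXc.exists_seq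
  choose S hS using fun Y : {Y : Submodule R X // Y.FG} =>
    hN.exists_finset_sum_eq_of_baseChange A ψ Y.2
  have hfgnext : ∀ (n : ℕ) (Y : {Y : Submodule R X // Y.FG}),
      (Y.1 ⊔ R ∙ s n ⊔ (S Y).sup LinearMap.range).FG := fun n Y =>
    (Y.2.sup (Submodule.fg_span_singleton _)).sup
      (Submodule.fg_finset_sup _ _ fun h _ => by
        rw [LinearMap.range_eq_map]; exact (Module.Finite.fg_top).map h)
  let W : ℕ → {Y : Submodule R X // Y.FG} := fun n =>
    Nat.rec ⟨⊥, Submodule.fg_bot⟩ (fun n Y => ⟨_, hfgnext n Y⟩) n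
  let Y : ℕ → Submodule R X := fun n => (W n).1
  have hW : ∀ n, Y (n + 1) = Y n ⊔ R ∙ s n ⊔ (S (W n)).sup LinearMap.range := fun n => rfl
  have hY : Monotone Y := monotone_nat_of_le_succ fun n => by
    rw [hW]; exact le_sup_of_le_left le_sup_left
  have hex : ∀ x, ∃ n, x ∈ Y n := by
    intro x
    have : (⊤ : Submodule R X) ≤ ⨆ n, Y n := by
      rw [← hs, Submodule.span_le]
      rintro _ ⟨n, rfl⟩
      refine Submodule.mem_iSup_of_mem (n + 1) ?_
      rw [hW]
      exact Submodule.mem_sup_left (Submodule.mem_sup_right (Submodule.mem_span_singleton_self _))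
    exact (Submodule.mem_iSup_of_directed Y hY.directed_le).1 (this Submodule.mem_top)
  -- Taking `Z = Y (n + 2)` leaves room for the index lost in the extension: the maps `g n h` extend
  -- to `X` from their restrictions to `Y (n + 1)`, which contains `Y n`.
  choose g hg using fun n => hS (W n) (Y (n + 2)) (W (n + 2)).2 (hY (Nat.le_add_right n 2))
  have hran : ∀ n (h : S (W n)) m, h.1 m ∈ Y (n + 1) := fun n h m => by
    rw [hW]
    exact Submodule.mem_sup_right
      (Finset.le_sup (f := LinearMap.range) h.2 (LinearMap.mem_range_self h.1 m))
  let e : ∀ n, Y (n + 2) →ₗ[R] Y (n + 1) := fun n =>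
    (∑ h, h.1 ∘ₗ g n h).codRestrict (Y (n + 1)) fun y => by
      simpa using sum_mem fun h _ => hran n h _
  have he : ∀ n x (hx : x ∈ Y n),
      e n ⟨x, hY (Nat.le_add_right n 2) hx⟩ = ⟨x, hY n.le_succ hx⟩ := by
    intro n x hx
    ext
    simpa [e] using hg n x (hY (Nat.le_add_right n 2) hx) hx
  have hext : ∀ n (h : S (W n)), ∃ ψ : X →ₗ[R] M, ∀ x (hx : x ∈ Y (n + 1)),
      ψ x = g n h ⟨x, hY (n + 1).le_succ hx⟩ := fun n h =>
    exists_linearMap_extending (fun j => Y (n + 1 + j)) (fun _ _ hab => hY (by omega))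
      (fun x => (hex x).imp fun m hm => hY (by omega) hm) (fun j => e (n + 1 + j))
      (fun j => he (n + 1 + j)) (g n h)
  choose G hG using hext
  obtain ⟨i, p, hip⟩ := exists_leftInverse_of_approx Y hY hex (κ := fun n => S (W n))
    (fun n h => h.1) G
    (fun n x hx => by
      simp only [hG n _ x (hY n.le_succ hx)]
      exact hg n x _ hx)
    (fun n x => sum_mem fun h _ => hran n h _)
  -- The index type is countable, so it can be moved to the universe required by `MemAdd`.
  let E := Finsupp.domLCongr (M := M) (R := R) (equivShrink.{w} (Σ n, S (W n)))
  exact memAdd_of_leftInverse (E.toLinearMap ∘ₗ i) (p ∘ₗ E.symm.toLinearMap)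
    fun x => by simp [hip]

theorem IsCountablyGenerated.of_baseChange {R : Type u} [CommRing R]
    (A : Type x) [CommRing A] [Algebra R A] [Module.FaithfullyFlat R A]
    {X : Type w} [AddCommGroup X] [Module R X] (h : IsCountablyGenerated A (A ⊗[R] X)) :
    IsCountablyGenerated R X := by
  classical
  obtain ⟨s, hs, hspan⟩ := h
  choose T hT using fun z : A ⊗[R] X => TensorProduct.exists_finset z
  refine ⟨⋃ z ∈ s, ((T z).image Prod.snd : Finset X), hs.biUnion fun z _ =>
    Finset.countable_toSet _, ?_⟩
  set I := Submodule.span R (⋃ z ∈ s, (((T z).image Prod.snd : Finset X) : Set X)) with hI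
  rw [eq_top_iff]
  intro x _
  refine Submodule.mem_of_one_tmul_mem_baseChange A I ?_
  have : (⊤ : Submodule A (A ⊗[R] X)) ≤ I.baseChange A := by
    rw [← hspan, Submodule.span_le]
    intro z hz
    rw [hT z]
    refine sum_mem fun i hi => Submodule.tmul_mem_baseChange_of_mem _ (Submodule.subset_span ?_)
    exact Set.mem_biUnion hz (Finset.mem_coe.2 (Finset.mem_image_of_mem Prod.snd hi))
  exact this Submodule.mem_top

theorem isSMulRegular_baseChange {R : Type*} [CommRing R] (A : Type*) [CommRing A] [Algebra R A]
    [Module.Flat R A] {X : Type*} [AddCommGroup X] [Module R X] {a : R} (ha : IsSMulRegular X a) :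
    IsSMulRegular (A ⊗[R] X) (algebraMap R A a) := by
  have : Function.Injective ((LinearMap.lsmul R X a).lTensor A) :=
    Module.Flat.lTensor_preserves_injective_linearMap _ ha
  have h : ∀ z : A ⊗[R] X, algebraMap R A a • z = (LinearMap.lsmul R X a).lTensor A z := by
    intro z
    rw [algebraMap_smul]
    induction z with
    | zero => simp
    | tmul b x => simp
    | add y z hy hz => rw [smul_add, hy, hz, map_add]
  intro y z hyz
  exact this (by simpa [h] using hyz)

theorem MemAdd.isSMulRegular {A : Type u} [CommRing A] {M : Type v} [AddCommGroup M] [Module A M]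
    {N : Type w} [AddCommGroup N] [Module A N] (h : MemAdd A M N) {a : A}
    (ha : IsSMulRegular M a) : IsSMulRegular N a := by
  obtain ⟨ι, P, -, ⟨e⟩⟩ := h
  intro x y hxy
  refine e.injective (Subtype.ext (Finsupp.ext fun i => ha ?_))
  simpa using congrArg (fun z => (e z : ι →₀ M) i) hxy

/-! ### Patching a free submodule over `A` with its `R`-form -/

/-- Patching along `a`: if the `A`-module `N` contains a free module with `a`-power torsion
cokernel, then `N` is extended from `R`. -/
theorem exists_linearEquiv_baseChange_of_linearIndependent {R : Type u} [CommRing R]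
    {A : Type x} [CommRing A] [Algebra R A] [Module.Flat R A] (a : R)
    (hdense : ∀ (m : ℕ) (c : A), ∃ (r : R) (b : A),
      c = algebraMap R A r + algebraMap R A a ^ m * b)
    {N : Type w} [AddCommGroup N] [Module A N]
    (hreg : IsSMulRegular N (algebraMap R A a)) {Λ : Type*} (e : Λ → N)
    (hli : LinearIndependent A e)
    (he : ∀ n, ∃ m : ℕ, algebraMap R A a ^ m • n ∈ Submodule.span A (Set.range e)) :
    ∃ (X : Type w) (_ : AddCommGroup X) (_ : Module R X), Nonempty (N ≃ₗ[A] A ⊗[R] X) := by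
  classical
  let _ : Module R N := Module.compHom N (algebraMap R A)
  have : IsScalarTower R A N := ⟨fun r c n => by
    rw [Algebra.smul_def, mul_smul]; rfl⟩
  have hregR : IsSMulRegular N a := fun x y hxy => hreg (by simpa using hxy)
  let F : Submodule R N := Submodule.span R (Set.range e)
  have heF : ∀ l, e l ∈ F := fun l => Submodule.subset_span ⟨l, rfl⟩
  let X : Submodule R N :=
    { carrier := {n | ∃ m : ℕ, a ^ m • n ∈ F}
      zero_mem' := ⟨0, by simp⟩
      add_mem' := by
        rintro x y ⟨m, hm⟩ ⟨k, hk⟩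
        refine ⟨m + k, ?_⟩
        rw [smul_add]
        refine add_mem ?_ ?_
        · rw [add_comm, pow_add, mul_smul]; exact F.smul_mem _ hm
        · rw [pow_add, mul_smul]; exact F.smul_mem _ hk
      smul_mem' := by
        rintro r x ⟨m, hm⟩
        exact ⟨m, by rw [smul_comm]; exact F.smul_mem _ hm⟩ }
  have heX : ∀ l, e l ∈ X := fun l => ⟨0, by simpa using heF l⟩
  let Φ : A ⊗[R] X →ₗ[A] N := LinearMap.liftBaseChange A X.subtype
  have hΦ : ∀ b (x : X), Φ (b ⊗ₜ x) = b • (x : N) := fun b x => by simp [Φ]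
  have hsurj : Function.Surjective Φ := by
    intro n
    obtain ⟨m, hm⟩ := he n
    obtain ⟨c, hc⟩ := (Finsupp.mem_span_range_iff_exists_finsupp).1 hm
    choose r b hrb using hdense m
    -- Writing each coefficient as `c l = r + a ^ m * b`, the part `∑ b • e l` is removed from `n`;
    -- `a ^ m` sends the rest into the `R`-span `F`.
    let v : N := ∑ l ∈ c.support, b (c l) • e l
    have hv : n - v ∈ X := by
      refine ⟨m, ?_⟩
      have : a ^ m • (n - v) = ∑ l ∈ c.support, r (c l) • e l := by
        have h1 : a ^ m • n = ∑ l ∈ c.support, c l • e l := by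
          rw [← algebraMap_smul A, map_pow, ← hc]; rfl
        rw [smul_sub, h1, Finset.smul_sum, ← Finset.sum_sub_distrib]
        refine Finset.sum_congr rfl fun l _ => ?_
        rw [← algebraMap_smul A (a ^ m), smul_smul, map_pow, ← sub_smul,
          ← eq_sub_iff_add_eq.2 (hrb (c l)).symm, algebraMap_smul]
      rw [this]
      exact sum_mem fun l _ => F.smul_mem _ (Submodule.subset_span ⟨l, rfl⟩)
    refine ⟨1 ⊗ₜ ⟨n - v, hv⟩ + ∑ l ∈ c.support, b (c l) ⊗ₜ ⟨e l, heX l⟩, ?_⟩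
    simp [hΦ, v]
  -- Some power of `a` moves any element of `A ⊗ X` into the image of the free module, on which `Φ`
  -- is injective; and `a` is regular on `A ⊗ X` by flatness.
  have hinj : Function.Injective Φ := by
    have hregX : IsSMulRegular X a := fun x y hxy =>
      Subtype.ext (hregR (by simpa using congrArg Subtype.val hxy))
    have hregAX := isSMulRegular_baseChange A hregX
    let Ψ : (Λ →₀ A) →ₗ[A] A ⊗[R] X :=
      Finsupp.linearCombination A fun l => (1 : A) ⊗ₜ (⟨e l, heX l⟩ : X)
    have hΦΨ : ∀ c, Φ (Ψ c) = Finsupp.linearCombination A e c := by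
      intro c
      simp [Ψ, Finsupp.linearCombination_apply, Finsupp.sum, hΦ]
    have hF : ∀ x : X, (x : N) ∈ F → (1 : A) ⊗ₜ[R] x ∈ LinearMap.range Ψ := by
      suffices ∀ x ∈ F, ∀ hx' : x ∈ X, (1 : A) ⊗ₜ[R] (⟨x, hx'⟩ : X) ∈ LinearMap.range Ψ from
        fun x hx => this x hx x.2
      intro x hx
      induction hx using Submodule.span_induction with
      | mem x h =>
        obtain ⟨l, rfl⟩ := h
        intro _
        exact ⟨Finsupp.single l 1, by simp [Ψ]⟩
      | zero =>
        intro hx'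
        have : (⟨0, hx'⟩ : X) = 0 := rfl
        rw [this, TensorProduct.tmul_zero]; exact zero_mem _
      | add x y hxF hyF h1 h2 =>
        intro hx'
        have hxX : x ∈ X := ⟨0, by simpa using hxF⟩
        have hyX : y ∈ X := ⟨0, by simpa using hyF⟩
        have : (⟨x + y, hx'⟩ : X) = ⟨x, hxX⟩ + ⟨y, hyX⟩ := rfl
        rw [this, TensorProduct.tmul_add]
        exact add_mem (h1 _) (h2 _)
      | smul r x hxF h1 =>
        intro hx'
        have hxX : x ∈ X := ⟨0, by simpa using hxF⟩
        have : (⟨r • x, hx'⟩ : X) = r • ⟨x, hxX⟩ := rfl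
        rw [this, TensorProduct.tmul_smul, ← algebraMap_smul A]
        exact Submodule.smul_mem _ _ (h1 _)
    have hpow : ∀ z : A ⊗[R] X, ∃ m : ℕ, algebraMap R A a ^ m • z ∈ LinearMap.range Ψ := by
      intro z
      induction z with
      | zero => exact ⟨0, by simp⟩
      | tmul b x =>
        obtain ⟨m, hm⟩ := x.2
        refine ⟨m, ?_⟩
        have : algebraMap R A a ^ m • (b ⊗ₜ[R] x) = b • ((1 : A) ⊗ₜ[R] (a ^ m • x)) := by
          rw [TensorProduct.tmul_smul, ← map_pow, algebraMap_smul, smul_comm b]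
          simp [TensorProduct.smul_tmul']
        rw [this]
        exact Submodule.smul_mem _ _ (hF _ hm)
      | add y z hy hz =>
        obtain ⟨m, hm⟩ := hy
        obtain ⟨k, hk⟩ := hz
        refine ⟨m + k, ?_⟩
        rw [smul_add]
        refine add_mem ?_ ?_
        · rw [add_comm, pow_add, mul_smul]; exact Submodule.smul_mem _ _ hm
        · rw [pow_add, mul_smul]; exact Submodule.smul_mem _ _ hk
    rw [← LinearMap.ker_eq_bot, LinearMap.ker_eq_bot']
    intro z hz
    obtain ⟨m, c, hc⟩ := hpow z
    have hc0 : c = 0 := by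
      refine (LinearMap.ker_eq_bot'.1 (LinearMap.ker_eq_bot.2 hli)) c ?_
      rw [← hΦΨ, hc, map_smul, hz, smul_zero]
    rw [hc0, map_zero] at hc
    exact (hregAX.pow m) (by simpa using hc.symm)
  exact ⟨X, inferInstance, inferInstance, ⟨(LinearEquiv.ofBijective Φ ⟨hinj, hsurj⟩).symm⟩⟩

/-- If `N` becomes free over the total quotient ring, then it contains a free module with
cokernel torsion with respect to the non-zero-divisors. -/
theorem exists_linearIndependent_of_linearEquiv_fractionRing {A : Type u} [CommRing A]
    {N : Type w} [AddCommGroup N] [Module A N] {Λ : Type*}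
    (φ : (FractionRing A ⊗[A] N) ≃ₗ[FractionRing A] (Λ →₀ FractionRing A)) :
    ∃ e : Λ → N, LinearIndependent A e ∧
      ∀ n, ∃ s ∈ nonZeroDivisors A, s • n ∈ Submodule.span A (Set.range e) := by
  classical
  let K := FractionRing A
  let ι : N →ₗ[A] K ⊗[A] N := TensorProduct.mk A K N 1
  have hloc : IsLocalizedModule (nonZeroDivisors A) ι :=
    (isLocalizedModule_iff_isBaseChange (nonZeroDivisors A) K _).2
      (TensorProduct.isBaseChange A N K)
  have h1 : ∀ l : Λ, ∃ (n : N) (s : nonZeroDivisors A),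
      s • φ.symm (Finsupp.single l 1) = ι n := fun l => by
    obtain ⟨⟨n, s⟩, h⟩ := IsLocalizedModule.surj (nonZeroDivisors A) ι (φ.symm (Finsupp.single l 1))
    exact ⟨n, s, h⟩
  choose e t ht using h1
  have hφe : ∀ l, φ (ι (e l)) = Finsupp.single l (algebraMap A K (t l)) := fun l => by
    rw [← ht, Submonoid.smul_def, ← algebraMap_smul K, map_smul, φ.apply_symm_apply,
      Finsupp.smul_single, smul_eq_mul, mul_one]
  have hφA : ∀ (b : A) z, φ (b • z) = b • φ z := fun b z => by
    rw [← algebraMap_smul K, map_smul, algebraMap_smul]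
  -- In the coordinates given by `φ`, the family `e` is diagonal with non-zero-divisor entries `t
  -- l`.
  have hφc : ∀ c : Λ →₀ A, ∀ l, φ (ι (Finsupp.linearCombination A e c)) l =
      algebraMap A K (c l * t l) := by
    intro c l
    induction c using Finsupp.induction_linear with
    | zero => simp
    | add f g hf hg => simp only [map_add, Finsupp.add_apply, hf, hg, add_mul]
    | single k b =>
      rw [Finsupp.linearCombination_single, map_smul, hφA, hφe, Finsupp.smul_single,
        Algebra.smul_def, ← map_mul]
      by_cases h : k = l
      · subst h; simp
      · simp [h]
  refine ⟨e, ?_, fun n => ?_⟩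
  · rw [linearIndependent_iff]
    intro c hc
    ext l
    have h := hφc c l
    rw [hc, map_zero, map_zero, Finsupp.zero_apply] at h
    have h' : c l * t l = 0 := IsFractionRing.injective A K (by rw [← h, map_zero])
    exact (mul_right_mem_nonZeroDivisors_eq_zero_iff (t l).2).1 h'
  · have key : ∀ f : Λ →₀ K, ∃ s ∈ nonZeroDivisors A, ∃ c : Λ →₀ A,
        s • φ.symm f = ι (Finsupp.linearCombination A e c) := by
      intro f
      induction f using Finsupp.induction_linear with
      | zero => exact ⟨1, one_mem _, 0, by simp⟩
      | add f g hf hg =>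
        obtain ⟨s, hs, c, hc⟩ := hf
        obtain ⟨s', hs', c', hc'⟩ := hg
        refine ⟨s * s', mul_mem hs hs', s' • c + s • c', ?_⟩
        simp only [map_add, map_smul, ← hc, ← hc', smul_add, smul_smul, mul_comm s' s]
      | single l k =>
        obtain ⟨⟨b, s⟩, hk⟩ := IsLocalization.surj (nonZeroDivisors A) k
        refine ⟨s * t l, mul_mem s.2 (t l).2, Finsupp.single l b, ?_⟩
        apply φ.injective
        rw [Finsupp.linearCombination_single, ι.map_smul, hφA, hφA, hφe, φ.apply_symm_apply]
        simp only [Finsupp.smul_single, Algebra.smul_def, map_mul] at hk ⊢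
        rw [← hk]; congr 1; ring
    obtain ⟨s, hs, c, hc⟩ := key (φ (ι n))
    rw [φ.symm_apply_apply, ← map_smul] at hc
    obtain ⟨t', ht'⟩ := IsLocalizedModule.exists_of_eq (S := nonZeroDivisors A) hc
    refine ⟨t' * s, mul_mem t'.2 hs, ?_⟩
    rw [mul_smul]
    change t' • s • n ∈ _
    rw [ht']
    exact Submodule.smul_mem _ _ (Finsupp.mem_span_range_iff_exists_finsupp.2 ⟨c, rfl⟩)

/-! ### The completion in dimension one -/

section

open IsLocalRing

theorem IsHausdorff.submodule {A : Type*} [CommRing A] (I : Ideal A) {M : Type*} [AddCommGroup M]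
    [Module A M] [IsHausdorff I M] (P : Submodule A M) : IsHausdorff I P where
  haus' x hx := by
    refine Subtype.ext (IsHausdorff.haus ‹_› (x : M) fun n => ?_)
    have h := hx n
    rw [SModEq.zero] at h ⊢
    have h' := Submodule.mem_map_of_mem (f := P.subtype) h
    rw [Submodule.map_smul''] at h'
    exact Submodule.smul_mono le_rfl le_top h'

theorem IsPrecomplete.pi {A : Type*} [CommRing A] (I : Ideal A) (ι : Type*) [Finite ι]
    [IsPrecomplete I A] : IsPrecomplete I (ι → A) where
  prec' f hf := by
    classical
    have := Fintype.ofFinite ι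
    have hcoord : ∀ i, ∃ L : A, ∀ n, f n i ≡ L [SMOD (I ^ n • ⊤ : Submodule A A)] := fun i =>
      IsPrecomplete.prec ‹_› fun {m n} hmn => by
        have h := hf hmn
        rw [SModEq.sub_mem] at h ⊢
        have h' := Submodule.mem_map_of_mem (f := LinearMap.proj (R := A) (φ := fun _ => A) i) h
        rw [Submodule.map_smul''] at h'
        exact Submodule.smul_mono le_rfl le_top h'
    choose L hL using hcoord
    refine ⟨L, fun n => ?_⟩
    rw [SModEq.sub_mem, ← Finset.univ_sum_single (f n - L)]
    refine sum_mem fun i _ => ?_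
    have h := SModEq.sub_mem.1 (hL i n)
    have h' := Submodule.mem_map_of_mem (f := LinearMap.single A (fun _ : ι => A) i) h
    rw [Submodule.map_smul''] at h'
    exact Submodule.smul_mono le_rfl le_top h'

theorem IsLocalRing.exists_mem_maximalIdeal_ne_zero {R : Type*} [CommRing R] [IsDomain R]
    [IsLocalRing R] (hdim : ringKrullDim R = 1) : ∃ a ∈ maximalIdeal R, a ≠ 0 := by
  refine Submodule.exists_mem_ne_zero_of_ne_bot fun h => ?_
  have := (IsLocalRing.isField_iff_maximalIdeal_eq (R := R)).2 h
  rw [ringKrullDim_eq_zero_of_isField this] at hdim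
  exact zero_ne_one hdim

theorem IsLocalRing.exists_pow_maximalIdeal_le_span {R : Type*} [CommRing R] [IsDomain R]
    [IsLocalRing R] [IsNoetherianRing R] (hdim : ringKrullDim R = 1) {a : R} (ha : a ≠ 0) :
    ∃ n : ℕ, maximalIdeal R ^ n ≤ Ideal.span {a} := by
  refine Ideal.exists_pow_le_of_le_radical_of_fg ?_ (IsNoetherian.noetherian _)
  have : Ring.KrullDimLE 1 R := Order.krullDimLE_iff _ _ |>.2 hdim.le
  rw [Ideal.radical_eq_sInf]
  refine le_sInf fun P hP => ?_
  have hP' := hP.2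
  have hne : P ≠ ⊥ := fun h => ha (by simpa [h] using hP.1 (Ideal.mem_span_singleton_self a))
  exact (eq_maximalIdeal (Ring.krullDimLE_one_iff_of_noZeroDivisors.1 this P hne hP')).ge

variable {R : Type u} [CommRing R] [IsDomain R] [IsLocalRing R] [IsNoetherianRing R]

instance LocalCompletion.faithfullyFlat : Module.FaithfullyFlat R (LocalCompletion R) :=
  Module.FaithfullyFlat.of_flat_of_isLocalHom

/-- A power of the maximal ideal lies in `(a)`, and `R` surjects onto the quotient of the completion
by that power. -/
theorem LocalCompletion.exists_eq_algebraMap_add_mul (hdim : ringKrullDim R = 1) {a : R}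
    (ha : a ≠ 0) (c : LocalCompletion R) :
    ∃ (r : R) (b : LocalCompletion R), c = algebraMap R _ r + algebraMap R _ a * b := by
  obtain ⟨n, hn⟩ := IsLocalRing.exists_pow_maximalIdeal_le_span hdim ha
  obtain ⟨r, hr⟩ := Submodule.Quotient.mk_surjective _
    (AdicCompletion.eval (maximalIdeal R) R n c)
  have h : c - algebraMap R (LocalCompletion R) r ∈
      (maximalIdeal R ^ n • ⊤ : Submodule R (LocalCompletion R)) := by
    rw [AdicCompletion.pow_smul_top_eq_ker_eval (IsNoetherian.noetherian _), LinearMap.mem_ker,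
      map_sub, ← hr, sub_eq_zero]
    rfl
  have h' := Submodule.smul_mono_left hn h
  rw [Submodule.ideal_span_singleton_smul, Submodule.mem_smul_pointwise_iff_exists] at h'
  obtain ⟨b, -, hb⟩ := h'
  exact ⟨r, b, by rw [← Algebra.smul_def, hb]; ring⟩

/-- By Cohen's theorem only primes `P` matter. Modulo `α` the ring is a quotient of `R`, so `P ≤ P₀
+ (α)` with `P₀ ≤ P` finitely generated. If `α ∉ P`, primality improves this to `P = P₀ + αP`, and
completeness gives `P = P₀` by successive approximation. -/
theorem LocalCompletion.isNoetherianRing (hdim : ringKrullDim R = 1) :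
    IsNoetherianRing (LocalCompletion R) := by
  obtain ⟨a, ham, ha⟩ := IsLocalRing.exists_mem_maximalIdeal_ne_zero hdim
  let A := LocalCompletion R
  let α : A := algebraMap R A a
  have hα : α ∈ maximalIdeal A := by
    rw [AdicCompletion.maximalIdeal_eq_map]; exact Ideal.mem_map_of_mem _ ham
  have hquot : IsNoetherianRing (A ⧸ Ideal.span {α}) := by
    refine isNoetherianRing_of_surjective R _ ((Ideal.Quotient.mk _).comp (algebraMap R A)) ?_
    intro z
    obtain ⟨c, rfl⟩ := Ideal.Quotient.mk_surjective z
    obtain ⟨r, b, hc⟩ := exists_eq_algebraMap_add_mul hdim ha c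
    refine ⟨r, ?_⟩
    rw [RingHom.comp_apply, Ideal.Quotient.eq, Ideal.mem_span_singleton']
    exact ⟨-b, by rw [hc]; ring⟩
  refine IsNoetherianRing.of_prime fun P hP => ?_
  obtain ⟨T, hT⟩ := (isNoetherianRing_iff_ideal_fg _).1 hquot (P.map (Ideal.Quotient.mk _))
  have hT' : ∀ t ∈ T, ∃ p ∈ P, Ideal.Quotient.mk (Ideal.span {α}) p = t := fun t ht =>
    (Ideal.mem_map_iff_of_surjective _ Ideal.Quotient.mk_surjective).1
      (hT ▸ Ideal.subset_span ht)
  choose p hp hpt using hT'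
  let P₀ : Ideal A := Ideal.span (Set.range fun t : T => p t.1 t.2)
  have hP₀ : P₀ ≤ P := by
    rw [Ideal.span_le]; rintro _ ⟨t, rfl⟩; exact hp _ _
  have hP₀fg : P₀.FG := Submodule.fg_span (Set.finite_range _)
  have hle : P ≤ P₀ ⊔ Ideal.span {α} := by
    have : P.map (Ideal.Quotient.mk (Ideal.span {α})) ≤ P₀.map (Ideal.Quotient.mk _) := by
      rw [← hT, Ideal.span_le]
      intro t ht
      rw [← hpt t ht]
      exact Ideal.mem_map_of_mem _ (Ideal.subset_span ⟨⟨t, ht⟩, rfl⟩)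
    rw [Ideal.map_le_iff_le_comap, Ideal.comap_map_of_surjective' _ Ideal.Quotient.mk_surjective,
      Ideal.mk_ker] at this
    exact this
  by_cases hαP : α ∈ P
  · have : P = P₀ ⊔ Ideal.span {α} :=
      le_antisymm hle (sup_le hP₀ ((Ideal.span_singleton_le_iff_mem _).2 hαP))
    rw [this]
    exact Submodule.FG.sup hP₀fg (Submodule.fg_span_singleton α)
  · let L : (T → A) →ₗ[A] P := (Fintype.linearCombination A fun t : T => (⟨p t.1 t.2, hp _ _⟩ : P))
    have hsurj : Function.Surjective L := by
      have : IsHausdorff (maximalIdeal A) P := IsHausdorff.submodule _ _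
      have : IsPrecomplete (maximalIdeal A) (T → A) := IsPrecomplete.pi _ _
      refine surjective_of_mkQ_comp_surjective (I := maximalIdeal A) ?_
      intro y
      obtain ⟨⟨x, hx⟩, rfl⟩ := Submodule.mkQ_surjective _ y
      obtain ⟨x₀, hx₀, z, hz, hxz⟩ := Submodule.mem_sup.1 (hle hx)
      obtain ⟨b, rfl⟩ := Ideal.mem_span_singleton.1 hz
      obtain ⟨c, hc⟩ := (Submodule.mem_span_range_iff_exists_fun A).1 hx₀
      refine ⟨c, ?_⟩
      have hb : b ∈ P := (hP.mem_or_mem (by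
        rw [← sub_eq_iff_eq_add'.2 hxz.symm]; exact sub_mem hx (hP₀ hx₀))).resolve_left hαP
      symm
      rw [LinearMap.comp_apply, ← sub_eq_zero, ← map_sub, Submodule.mkQ_apply,
        Submodule.Quotient.mk_eq_zero]
      have : (⟨x, hx⟩ : P) - L c = α • ⟨b, hb⟩ := by
        apply Subtype.ext
        simp [L, Fintype.linearCombination_apply, ← hxz, ← hc]
      rw [this]
      exact Submodule.smul_mem_smul hα Submodule.mem_top
    exact (Module.Finite.iff_fg).1 (Module.Finite.of_surjective L hsurj)

/-- By Krull's principal ideal theorem the maximal ideal has height at most one, so every other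
prime is minimal and consists of zero divisors. Hence a prime containing `s` is maximal and contains
`a`. -/
theorem LocalCompletion.exists_dvd_pow (hdim : ringKrullDim R = 1) {a : R} (ha : a ≠ 0)
    (ham : a ∈ maximalIdeal R) {s : LocalCompletion R} (hs : s ∈ nonZeroDivisors (LocalCompletion R)) :
    ∃ m : ℕ, s ∣ algebraMap R (LocalCompletion R) a ^ m := by
  have := LocalCompletion.isNoetherianRing hdim
  let A := LocalCompletion R
  let α : A := algebraMap R A a
  have hα : α ∈ maximalIdeal A := by
    rw [AdicCompletion.maximalIdeal_eq_map]
    exact Ideal.mem_map_of_mem _ ham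
  obtain ⟨n, hn⟩ := IsLocalRing.exists_pow_maximalIdeal_le_span hdim ha
  have hmin : maximalIdeal A ∈ (Ideal.span {α}).minimalPrimes := by
    refine ⟨⟨inferInstance, (Ideal.span_singleton_le_iff_mem _).2 hα⟩, fun Q ⟨hQ, hQα⟩ _ => ?_⟩
    -- The exponent is `n + 1` because it must be nonzero, while `n` may be zero.
    refine (hQ.pow_le_iff (n := n + 1) (by omega)).1 ?_
    rw [AdicCompletion.maximalIdeal_eq_map, ← Ideal.map_pow]
    refine (Ideal.map_mono ((Ideal.pow_le_pow_right n.le_succ).trans hn)).trans ?_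
    rwa [Ideal.map_span, Set.image_singleton]
  have hht := Ideal.height_le_one_of_isPrincipal_of_mem_minimalPrimes _ _ hmin
  have hrad : α ∈ (Ideal.span {s}).radical := by
    rw [Ideal.radical_eq_sInf, Submodule.mem_sInf]
    rintro P ⟨hsP, hP⟩
    have hPm : P = maximalIdeal A := by
      by_contra hne
      have hlt : P < maximalIdeal A := lt_of_le_of_ne (le_maximalIdeal hP.ne_top) hne
      have h0 : Ideal.height P = 0 := by
        have := Ideal.height_strict_mono_of_isPrime_of_isPrime hlt
        exact Order.lt_one_iff.1 (this.trans_le hht)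
      have hPmin : P ∈ minimalPrimes A := Ideal.height_eq_zero_iff.1 h0
      exact notMem_nonZeroDivisors_of_mem_mem_minimalPrimes 
        (hsP (Ideal.mem_span_singleton_self s)) hPmin hs
    rwa [hPm]
  obtain ⟨m, hm⟩ := hrad
  exact ⟨m, Ideal.mem_span_singleton.1 hm⟩

end

/-! ### Countability, universes and generic freeness -/

/-- A basis of a countably generated module over a nontrivial ring is countable. -/
theorem IsCountablyGenerated.countable_of_finsupp {K : Type u} [CommRing K] [Nontrivial K]
    {Λ : Type v} (h : IsCountablyGenerated K (Λ →₀ K)) : Countable Λ := by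
  obtain ⟨s, hs, hspan⟩ := h
  let T : Set Λ := ⋃ z ∈ s, (z.support : Set Λ)
  have hT : T.Countable := hs.biUnion fun z _ => Finset.countable_toSet _
  have hle : (⊤ : Submodule K (Λ →₀ K)) ≤ Finsupp.supported K K T := by
    rw [← hspan, Submodule.span_le]
    intro z hz
    exact Set.subset_biUnion_of_mem (u := fun z : Λ →₀ K => (z.support : Set Λ)) hz
  have : T = Set.univ := Set.eq_univ_of_forall fun l => by
    have h := hle (Submodule.mem_top (x := Finsupp.single l (1 : K)))
    exact h (by simp)
  rw [this] at hT
  exact Set.countable_univ_iff.1 hT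

theorem IsCountablyGenerated.baseChange {A : Type u} [CommRing A] (K : Type v) [CommRing K]
    [Algebra A K] {N : Type w} [AddCommGroup N] [Module A N] (h : IsCountablyGenerated A N) :
    IsCountablyGenerated K (K ⊗[A] N) := by
  obtain ⟨s, hs, hspan⟩ := h
  refine ⟨TensorProduct.mk A K N 1 '' s, hs.image _, ?_⟩
  rw [← Submodule.baseChange_span, hspan, Submodule.baseChange_top]

theorem IsCountablyGenerated.of_surjective {A : Type u} [CommRing A] {N : Type w} [AddCommGroup N]
    [Module A N] {P : Type v} [AddCommGroup P] [Module A P] (h : IsCountablyGenerated A N)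
    (f : N →ₗ[A] P) (hf : Function.Surjective f) : IsCountablyGenerated A P := by
  obtain ⟨s, hs, hspan⟩ := h
  exact ⟨f '' s, hs.image _, by
    rw [Submodule.span_image, hspan, Submodule.map_top, LinearMap.range_eq_top.2 hf]⟩

/-- A countably generated module has a copy in every universe above the one of the ring. -/
theorem IsCountablyGenerated.exists_linearEquiv {R : Type u} [CommRing R] {X : Type w}
    [AddCommGroup X] [Module R X] (h : IsCountablyGenerated R X) :
    ∃ (X' : Type (max u x)) (_ : AddCommGroup X') (_ : Module R X'), Nonempty (X ≃ₗ[R] X') := by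
  obtain ⟨s, hs⟩ := h.exists_seq
  let f : (ℕ →₀ R) →ₗ[R] X := Finsupp.linearCombination R s
  have hf : Function.Surjective f := by
    rw [← LinearMap.range_eq_top, Finsupp.range_linearCombination, hs]
  exact ⟨ULift.{x} ((ℕ →₀ R) ⧸ LinearMap.ker f), inferInstance, inferInstance,
    ⟨(f.quotKerEquivOfSurjective hf).symm ≪≫ₗ ULift.moduleEquiv.symm⟩⟩

/-- Base change of a module over a domain to the total quotient ring of a flat extension is
free. -/
theorem exists_linearEquiv_finsupp_fractionRing {R : Type u} [CommRing R] [IsDomain R]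
    (A : Type v) [CommRing A] [Algebra R A] [Module.Flat R A]
    (X : Type w) [AddCommGroup X] [Module R X] :
    ∃ Λ : Type (max u w), Nonempty ((FractionRing A ⊗[A] (A ⊗[R] X))
      ≃ₗ[FractionRing A] (Λ →₀ FractionRing A)) := by
  let Q := FractionRing R
  let K := FractionRing A
  -- By flatness nonzero elements of `R` stay non-zero-divisors in `A`, hence become units in `K`;
  -- this makes `K` an algebra over the field `Q`.
  have hunit : ∀ r : nonZeroDivisors R, IsUnit (algebraMap R K r) := by
    intro r
    rw [IsScalarTower.algebraMap_apply R A K]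
    refine IsLocalization.map_units K (⟨algebraMap R A r, ?_⟩ : nonZeroDivisors A)
    have h := isSMulRegular_baseChange A (X := R) (a := (r : R)) fun x y hxy =>
      mul_left_cancel₀ (nonZeroDivisors.ne_zero r.2) hxy
    rw [mem_nonZeroDivisors_iff_right]
    intro y hy
    apply (TensorProduct.rid R A).symm.injective
    apply h
    simpa [TensorProduct.smul_tmul', Algebra.smul_def, mul_comm] using
      congrArg (· ⊗ₜ[R] (1 : R)) hy
  let _ : Algebra Q K := (IsLocalization.lift (M := nonZeroDivisors R) (S := Q) hunit).toAlgebra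
  have : IsScalarTower R Q K := IsScalarTower.of_algebraMap_eq fun r =>
    (IsLocalization.lift_eq hunit r).symm
  let b := Module.Free.chooseBasis Q (Q ⊗[R] X)
  let e₁ : K ⊗[A] (A ⊗[R] X) ≃ₗ[K] K ⊗[R] X :=
    TensorProduct.AlgebraTensorModule.cancelBaseChange R A K K X
  let e₂ : K ⊗[Q] (Q ⊗[R] X) ≃ₗ[K] K ⊗[R] X :=
    TensorProduct.AlgebraTensorModule.cancelBaseChange R Q K K X
  exact ⟨_, ⟨e₁ ≪≫ₗ e₂.symm ≪≫ₗ (b.baseChange K).repr⟩⟩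

/-! ### The equivalence -/

theorem mainTheorem1
    (R : Type u) [CommRing R] [IsDomain R] [IsLocalRing R] [IsNoetherianRing R]
    (hdim : ringKrullDim R = 1)
    (hred : IsReduced (LocalCompletion R))
    (M : Type v) [AddCommGroup M] [Module R M] [Module.Finite R M] [Module.IsTorsionFree R M]
    (N : Type w) [AddCommGroup N] [Module (LocalCompletion R) N]
    (hNcg : IsCountablyGenerated (LocalCompletion R) N)
    (hN : MemAdd (LocalCompletion R) (LocalCompletion R ⊗[R] M) N) :
    List.TFAE [
      ∃ (X : Type (max u x)) (_ : AddCommGroup X) (_ : Module R X), IsExtendedFrom R N X,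
      ∃ Λ : Type, Countable Λ ∧
        Nonempty ((FractionRing (LocalCompletion R) ⊗[LocalCompletion R] N)
          ≃ₗ[FractionRing (LocalCompletion R)] (Λ →₀ FractionRing (LocalCompletion R))),
      ∃ (X : Type (max u x)) (_ : AddCommGroup X) (_ : Module R X),
        IsCountablyGenerated R X ∧ MemAdd R M X ∧ IsExtendedFrom R N X] := by
  tfae_have 1 → 2 := by
    rintro ⟨X, _, _, ⟨e⟩⟩
    obtain ⟨Λ, ⟨φ⟩⟩ := exists_linearEquiv_finsupp_fractionRing (R := R) (LocalCompletion R) X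
    let φ' := (LinearEquiv.baseChange (LocalCompletion R) (FractionRing (LocalCompletion R)) _ _ e)
      ≪≫ₗ φ
    have hΛ : Countable Λ := ((hNcg.baseChange (FractionRing (LocalCompletion R))).of_surjective
      φ'.toLinearMap φ'.surjective).countable_of_finsupp
    exact ⟨Shrink.{0} Λ, (equivShrink.{0} Λ).symm.injective.countable,
      ⟨φ' ≪≫ₗ Finsupp.domLCongr (equivShrink.{0} Λ)⟩⟩
  tfae_have 2 → 3 := by
    rintro ⟨Λ, -, ⟨φ⟩⟩
    obtain ⟨a, ham, ha⟩ := IsLocalRing.exists_mem_maximalIdeal_ne_zero hdim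
    obtain ⟨e, hli, he⟩ := exists_linearIndependent_of_linearEquiv_fractionRing φ
    obtain ⟨X, _, _, ⟨ψ⟩⟩ := exists_linearEquiv_baseChange_of_linearIndependent a
      (fun m c => by
        simpa using LocalCompletion.exists_eq_algebraMap_add_mul hdim (pow_ne_zero m ha) c)
      (hN.isSMulRegular (isSMulRegular_baseChange _
        ((IsRegular.of_ne_zero ha).isSMulRegular))) e hli
      (fun n => by
        obtain ⟨s, hs, hsn⟩ := he n
        obtain ⟨m, t, ht⟩ := LocalCompletion.exists_dvd_pow hdim ha ham hs
        refine ⟨m, ?_⟩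
        rw [ht, mul_comm, mul_smul]
        exact Submodule.smul_mem _ _ hsn)
    have hXc : IsCountablyGenerated R X :=
      (hNcg.of_surjective ψ.toLinearMap ψ.surjective).of_baseChange
    -- Patching builds `X` inside `N`, hence in the universe of `N`; a copy in the prescribed
    -- universe replaces it.
    obtain ⟨X', _, _, ⟨ε⟩⟩ := IsCountablyGenerated.exists_linearEquiv.{u, w, x} hXc
    let ψ' := ψ ≪≫ₗ ε.baseChange R (LocalCompletion R)
    have hXc' := hXc.of_surjective ε.toLinearMap ε.surjective
    exact ⟨X', inferInstance, inferInstance, hXc',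
      MemAdd.of_baseChange (LocalCompletion R) hXc' hN ψ', ⟨ψ'⟩⟩
  tfae_have 3 → 1 := by
    rintro ⟨X, _, _, -, -, h⟩
    exact ⟨X, _, _, h⟩
  tfae_finish
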